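/- Let $G$ be a finite simple connected bipartite graph with vertex set $V$, and let $K$ be a field. Let $$J_G=\bigl(x_iy_j-x_jy_i : \{i,j\}\text{ is an edge of }G\bigr)\subseteq K[x_v,y_v : v\in V]$$ be the binomial edge ideal of $G$, and let $\mathcal D(J_G)$ be its dual graph: the vertices of $\mathcal D(J_G)$ are the minimal primes of $J_G$, and two distinct minimal primes $\mathfrak p,\mathfrak q$ are adjacent if and only if $\operatorname{ht}(\mathfrak p+\mathfrak q)-1=\operatorname{ht}(\mathfrak p)=\operatorname{ht}(\mathfrak q)=\operatorname{ht}(J_G)$. For $S\subseteq V$ let $c_G(S)$ be the number of connected components of the subgraph of $G$ induced on $V\setminus S$, and call $S$ a cut set of $G$ if $S=\emptyset$ or $c_G(S\setminus\{i\})<c_G(S)$ for every $i\in S$. If $\mathcal D(J_G)$ is connected, then for every non-empty cut set $S$ of $G$ there exists $s\in S$ such that $S\setminus\{s\}$ is also a cut set of $G$. -/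

import Mathlib

namespace BinomialEdge

/-- The binomial edge ideal of a graph `G` on the vertex set `V` over `K`. The polynomial ring has
two variables for each vertex `v`: `x_v` is `X (Sum.inl v)` and `y_v` is `X (Sum.inr v)`. The ideal
is generated by the binomials `x_i y_j - x_j y_i` for the edges `{i, j}` of `G`; exchanging the two
endpoints of an edge only changes the sign of its generator. -/
noncomputable def binomialEdgeIdeal (K : Type*) [Field K] {V : Type*} (G : SimpleGraph V) :
    Ideal (MvPolynomial (V ⊕ V) K) :=
  Ideal.span {f | ∃ i j : V, G.Adj i j ∧
    f = MvPolynomial.X (Sum.inl i) * MvPolynomial.X (Sum.inr j)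
      - MvPolynomial.X (Sum.inl j) * MvPolynomial.X (Sum.inr i)}

/-- The dual graph of an ideal `I`: its vertices are the minimal primes of `I`, and two distinct
minimal primes `p`, `q` are adjacent when `ht (p + q) - 1 = ht p = ht q = ht I`. -/
def dualGraph {R : Type*} [CommRing R] (I : Ideal R) : SimpleGraph I.minimalPrimes where
  Adj p q := p ≠ q ∧ ((p : Ideal R) + (q : Ideal R)).height = (p : Ideal R).height + 1 ∧
    (p : Ideal R).height = I.height ∧ (q : Ideal R).height = I.height
  symm := ⟨fun p q h => ⟨h.1.symm, by
    rw [add_comm (q : Ideal R), h.2.1, h.2.2.1, h.2.2.2], h.2.2.2, h.2.2.1⟩⟩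
  loopless := ⟨fun _ h => h.1 rfl⟩

/-- `c_G(S)`: the number of connected components of the subgraph of `G` induced on the complement
of `S`. -/
noncomputable def numComponents {V : Type*} (G : SimpleGraph V) (S : Set V) : ℕ :=
  Nat.card (G.induce Sᶜ).ConnectedComponent

/-- `S` is a cut set of `G`: putting any single vertex of `S` back strictly decreases the number of
connected components. The empty set is a cut set. -/
def IsCutSet {V : Type*} (G : SimpleGraph V) (S : Set V) : Prop :=
  ∀ i ∈ S, numComponents G (S \ {i}) < numComponents G S

end BinomialEdge

/-! Minimal primes and cut sets. The minimal primes of the ideal are the primes `cutIdeal K G S` for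
cut sets S (`exists_isCutSet_of_mem_minimalPrimes`, `cutIdeal_mem_minimalPrimes`), of height |S| + n
- c(S) with n the number of vertices (`height_cutIdeal`). A connected dual graph forces all these
heights to agree, and comparison with S = ∅ gives c(S) = |S| + 1 for every cut set
(`isUnmixed_of_dualGraph_connected`).

Edges of the dual graph. If the primes of S and T are adjacent, some prime of height n contains
both. Counting its zero columns and its proportionality classes shows that S and T differ by one
vertex, or that S = R ∪ {s} and T = R ∪ {t} with R itself a cut set (`cutSets_of_height_sup`).

Diamond property. If R ∪ {v}, R ∪ {w} and R ∪ {v, w} are cut sets, so is R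
(`IsUnmixed.isCutSet_of_insert`); this is where bipartiteness enters, through
`IsUnmixed.false_of_bridge`. Hence the property of being built from ∅ one vertex at a time through
cut sets survives the removal of a vertex whenever a cut set remains (`UpReachable.of_insert`). It
therefore spreads along a path of the dual graph from ∅ to every cut set, and the last vertex added
in building S is the required s. -/

namespace BinomialEdge

/-! ### Components, cut sets and the unmixedness count. -/

section Graph

variable {V : Type*}

/-- The graph on the same vertices in which all edges meeting `S` are deleted. -/
def isolate (G : SimpleGraph V) (S : Set V) : SimpleGraph V where
  Adj u v := G.Adj u v ∧ u ∉ S ∧ v ∉ S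
  symm := ⟨fun _ _ h => ⟨h.1.symm, h.2.2, h.2.1⟩⟩
  loopless := ⟨fun _ h => G.loopless.irrefl _ h.1⟩

variable {G : SimpleGraph V}

lemma isolate_anti {S T : Set V} (h : S ⊆ T) : isolate G T ≤ isolate G S :=
  fun _ _ hab => ⟨hab.1, fun hs => hab.2.1 (h hs), fun hs => hab.2.2 (h hs)⟩

/-- Transports a path between two graphs along a set that it cannot leave. Taking `H' = ⊤` extracts
membership in K alone. -/
lemma reachable_of_closed {H H' : SimpleGraph V} {K : Set V}
    (hK : ∀ x ∈ K, ∀ y, H.Adj x y → y ∈ K ∧ H'.Adj x y) {u v : V} (hu : u ∈ K)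
    (h : H.Reachable u v) : v ∈ K ∧ H'.Reachable u v := by
  rw [SimpleGraph.reachable_iff_reflTransGen] at h
  induction h with
  | refl => exact ⟨hu, .rfl⟩
  | tail _ hbc ih => exact ⟨(hK _ ih.1 _ hbc).1, ih.2.trans (hK _ ih.1 _ hbc).2.reachable⟩

lemma eq_of_isolate_reachable {S : Set V} {u v : V} (hu : u ∈ S)
    (h : (isolate G S).Reachable u v) : v = u :=
  (reachable_of_closed (H' := ⊥) (K := {u})
    (fun x hx y hxy => by
      rw [Set.mem_singleton_iff] at hx
      exact absurd (hx ▸ hu) hxy.2.1) rfl h).1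

lemma notMem_of_isolate_reachable {S : Set V} {u v : V} (hu : u ∉ S)
    (h : (isolate G S).Reachable u v) : v ∉ S := fun hv => by
  have := eq_of_isolate_reachable hv h.symm
  exact hu (this ▸ hv)

lemma induce_reachable_iff {S : Set V} (u v : ↥Sᶜ) :
    (G.induce Sᶜ).Reachable u v ↔ (isolate G S).Reachable u v := by
  constructor
  · intro h
    exact h.map (G' := isolate G S)
      ⟨Subtype.val, fun {a b} hab => ⟨hab, a.2, b.2⟩⟩
  · intro h
    rw [SimpleGraph.reachable_iff_reflTransGen] at h
    obtain ⟨v, hv⟩ := v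
    change Relation.ReflTransGen _ _ v at h
    induction h with
    | refl => exact .rfl
    | tail _ hbc ih =>
      exact (ih hbc.2.1).trans (SimpleGraph.Adj.reachable (G := G.induce Sᶜ) hbc.1)

lemma numComponents_eq_ncard (S : Set V) :
    numComponents G S = ((isolate G S).connectedComponentMk '' Sᶜ).ncard := by
  rw [numComponents, ← Nat.card_coe_set_eq]
  refine Nat.card_congr (Equiv.ofBijective (Quot.lift
    (fun u : ↥Sᶜ => ⟨(isolate G S).connectedComponentMk u, u, u.2, rfl⟩) ?_) ⟨?_, ?_⟩)
  · intro u v h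
    exact Subtype.ext (SimpleGraph.ConnectedComponent.sound ((induce_reachable_iff u v).1 h))
  · rintro ⟨u⟩ ⟨v⟩ h
    exact SimpleGraph.ConnectedComponent.sound ((induce_reachable_iff u v).2
      (SimpleGraph.ConnectedComponent.exact (Subtype.ext_iff.1 h)))
  · rintro ⟨_, u, hu, rfl⟩
    exact ⟨Quot.mk _ ⟨u, hu⟩, rfl⟩

variable (G) in
/-- The components of the graph without `S` and `v` that are adjacent to `v`. -/
def attached (S : Set V) (v : V) : Set (isolate G (insert v S)).ConnectedComponent :=
  (isolate G (insert v S)).connectedComponentMk '' {u | G.Adj v u ∧ u ∉ S}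

/-- Deleting v leaves the other components untouched and breaks the component of v into the attached
ones. -/
lemma numComponents_insert [Finite V] {S : Set V} {v : V} (hv : v ∉ S) :
    numComponents G (insert v S) + 1 = numComponents G S + (attached G S v).ncard := by
  set H := isolate G S
  set H' := isolate G (insert v S) with hH'
  have hle : H' ≤ H := isolate_anti (Set.subset_insert _ _)
  set A' := H'.connectedComponentMk '' (insert v S)ᶜ
  set A := H.connectedComponentMk '' Sᶜ
  have hN : attached G S v ⊆ A' := by
    rintro _ ⟨u, hu, rfl⟩
    refine ⟨u, ?_, rfl⟩
    rintro (rfl | h)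
    exacts [G.loopless.irrefl _ hu.1, hu.2 h]
  have hvA : H.connectedComponentMk v ∈ A := ⟨v, hv, rfl⟩
  have key : ∀ a ∉ insert v S, H'.connectedComponentMk a ∉ attached G S v →
      ∀ b, H.Reachable a b → b ≠ v ∧ H'.Reachable a b := by
    intro a ha haN b hab
    have := reachable_of_closed (H := H) (H' := H') (K := {x | H'.Reachable a x}) ?_ .rfl hab
    · refine ⟨?_, this.2⟩
      rintro rfl
      exact notMem_of_isolate_reachable ha this.2 (Set.mem_insert _ _)
    · intro x hx y hxy
      have hxn := notMem_of_isolate_reachable ha hx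
      have hyv : y ≠ v := by
        rintro rfl
        exact haN ⟨x, ⟨hxy.1.symm, hxy.2.1⟩,
          SimpleGraph.ConnectedComponent.sound (SimpleGraph.Reachable.symm hx)⟩
      have hxy' : H'.Adj x y := ⟨hxy.1, hxn, by
        rintro (h | h)
        exacts [hyv h, hxy.2.2 h]⟩
      exact ⟨SimpleGraph.Reachable.trans hx hxy'.reachable, hxy'⟩
  have hcard : (A' \ attached G S v).ncard = (A \ {H.connectedComponentMk v}).ncard := by
    refine Set.ncard_congr (fun C _ => C.map (SimpleGraph.Hom.ofLE hle)) ?_ ?_ ?_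
    · rintro _ ⟨⟨a, ha, rfl⟩, haN⟩
      refine ⟨⟨a, fun h => ha (Or.inr h), rfl⟩, fun h => ?_⟩
      exact (key a ha haN v (SimpleGraph.ConnectedComponent.exact h)).1 rfl
    · rintro _ _ ⟨⟨a, ha, rfl⟩, haN⟩ ⟨⟨b, hb, rfl⟩, hbN⟩ h
      exact SimpleGraph.ConnectedComponent.sound
        (key a ha haN b (SimpleGraph.ConnectedComponent.exact h)).2
    · rintro _ ⟨⟨a, ha, rfl⟩, hav⟩
      refine ⟨H'.connectedComponentMk a, ⟨⟨a, ?_, rfl⟩, ?_⟩, rfl⟩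
      · rintro (rfl | h)
        exacts [hav rfl, ha h]
      · rintro ⟨u, hu, hua⟩
        refine hav (SimpleGraph.ConnectedComponent.sound ?_)
        have h1 : H.Reachable u a := (SimpleGraph.ConnectedComponent.exact hua).mono hle
        have h2 : H.Adj u v := ⟨hu.1.symm, hu.2, hv⟩
        exact h1.symm.trans h2.reachable
  have h1 := Set.ncard_sdiff_add_ncard_of_subset hN
  have h2 := Set.ncard_sdiff_singleton_add_one hvA
  rw [numComponents_eq_ncard, numComponents_eq_ncard]
  change A'.ncard + 1 = A.ncard + _
  omega

lemma two_le_attached_iff [Finite V] {S : Set V} {v : V} :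
    2 ≤ (attached G S v).ncard ↔ ∃ u w, G.Adj v u ∧ G.Adj v w ∧ u ∉ S ∧ w ∉ S ∧
      ¬ (isolate G (insert v S)).Reachable u w := by
  rw [Nat.succ_le_iff, Set.one_lt_ncard_iff]
  constructor
  · rintro ⟨_, _, ⟨u, hu, rfl⟩, ⟨w, hw, rfl⟩, h⟩
    exact ⟨u, w, hu.1, hw.1, hu.2, hw.2, fun h' => h (SimpleGraph.ConnectedComponent.sound h')⟩
  · rintro ⟨u, w, hu, hw, hu', hw', h⟩
    exact ⟨_, _, ⟨u, ⟨hu, hu'⟩, rfl⟩, ⟨w, ⟨hw, hw'⟩, rfl⟩,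
      fun h' => h (SimpleGraph.ConnectedComponent.exact h')⟩

lemma three_le_attached [Finite V] {S : Set V} {v a b c : V} (ha : G.Adj v a) (hb : G.Adj v b)
    (hc : G.Adj v c) (haS : a ∉ S) (hbS : b ∉ S) (hcS : c ∉ S)
    (hab : ¬ (isolate G (insert v S)).Reachable a b)
    (hac : ¬ (isolate G (insert v S)).Reachable a c)
    (hbc : ¬ (isolate G (insert v S)).Reachable b c) :
    3 ≤ (attached G S v).ncard := by
  rw [Nat.succ_le_iff, Set.two_lt_ncard_iff]
  exact ⟨_, _, _, ⟨a, ⟨ha, haS⟩, rfl⟩, ⟨b, ⟨hb, hbS⟩, rfl⟩, ⟨c, ⟨hc, hcS⟩, rfl⟩,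
    fun h => hab (SimpleGraph.ConnectedComponent.exact h),
    fun h => hac (SimpleGraph.ConnectedComponent.exact h),
    fun h => hbc (SimpleGraph.ConnectedComponent.exact h)⟩

lemma lt_numComponents_iff [Finite V] {S : Set V} {i : V} (hi : i ∈ S) :
    numComponents G (S \ {i}) < numComponents G S ↔ ∃ u w, G.Adj i u ∧ G.Adj i w ∧ u ∉ S ∧ w ∉ S ∧
      ¬ (isolate G S).Reachable u w := by
  obtain ⟨T, hiT, rfl⟩ : ∃ T, i ∉ T ∧ insert i T = S :=
    ⟨S \ {i}, by simp, by rw [Set.insert_sdiff_singleton, Set.insert_eq_of_mem hi]⟩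
  rw [Set.insert_sdiff_self_of_notMem hiT]
  have h := numComponents_insert (G := G) hiT
  have h2 := two_le_attached_iff (G := G) (S := T) (v := i)
  have : 2 ≤ (attached G T i).ncard ↔ numComponents G T < numComponents G (insert i T) := by
    omega
  rw [← this, h2]
  have aux : ∀ u, G.Adj i u → (u ∉ T ↔ u ∉ insert i T) := fun u hu => by
    simp [Set.mem_insert_iff, hu.ne']
  constructor
  · rintro ⟨u, w, hu, hw, hu', hw', h⟩
    exact ⟨u, w, hu, hw, (aux u hu).1 hu', (aux w hw).1 hw', h⟩
  · rintro ⟨u, w, hu, hw, hu', hw', h⟩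
    exact ⟨u, w, hu, hw, (aux u hu).2 hu', (aux w hw).2 hw', h⟩

lemma isCutSet_iff [Finite V] {S : Set V} :
    IsCutSet G S ↔ ∀ i ∈ S, ∃ u w, G.Adj i u ∧ G.Adj i w ∧ u ∉ S ∧ w ∉ S ∧
      ¬ (isolate G S).Reachable u w :=
  forall₂_congr fun _ hi => lt_numComponents_iff hi

lemma isCutSet_empty : IsCutSet G ∅ := fun _ hi => hi.elim

/-- The numerical condition on cut sets that is equivalent to unmixedness of the ideal. -/
def IsUnmixed (G : SimpleGraph V) : Prop :=
  ∀ S, IsCutSet G S → numComponents G S = S.ncard + 1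

/-- If S is not a cut set, some vertex can be put back without lowering the count, so the bound for
the smaller set suffices. -/
lemma IsUnmixed.numComponents_le [Finite V] (h : IsUnmixed G) (S : Set V) :
    numComponents G S ≤ S.ncard + 1 := by
  induction hn : S.ncard generalizing S with
  | zero =>
    rw [Set.ncard_eq_zero] at hn
    subst hn
    simpa using (h ∅ isCutSet_empty).le
  | succ n ih =>
    by_cases hS : IsCutSet G S
    · rw [h S hS, hn]
    · simp only [IsCutSet, not_forall, not_lt] at hS
      obtain ⟨i, hi, hle⟩ := hS
      have := ih (S \ {i}) (by rw [Set.ncard_sdiff_singleton_of_mem hi, hn]; rfl)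
      omega

/-- Putting a vertex back lowers the upper bound on the count to |S|. This turns lower bounds on
component counts into cut sets. -/
lemma IsUnmixed.isCutSet [Finite V] (h : IsUnmixed G) {S : Set V}
    (hS : S.ncard + 1 ≤ numComponents G S) : IsCutSet G S := by
  intro i hi
  have := h.numComponents_le (S \ {i})
  have := Set.ncard_sdiff_singleton_add_one hi
  omega

end Graph

/-! ### The diamond property and cut sets built one vertex at a time. -/

section Diamond

variable {V : Type*} {G : SimpleGraph V}

lemma isolate_reachable_insert {S : Set V} {a b w : V} (hab : (isolate G S).Reachable a b)
    (haw : ¬ (isolate G S).Reachable a w) : (isolate G (insert w S)).Reachable a b := by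
  refine (reachable_of_closed (H' := isolate G (insert w S))
    (K := {x | (isolate G S).Reachable a x}) (fun x hx y hxy => ?_) .rfl hab).2
  have hy : (isolate G S).Reachable a y := SimpleGraph.Reachable.trans hx hxy.reachable
  refine ⟨hy, hxy.1, ?_, ?_⟩
  · rintro (rfl | h)
    exacts [haw hx, hxy.2.1 h]
  · rintro (rfl | h)
    exacts [haw hy, hxy.2.2 h]

/-- Deleting w as well only refines components, so mapping them back covers every component attached
to v except possibly that of w. A drop from at least three to two thus forces w to be a neighbour of
v, alone among v's neighbours in its component. -/
lemma adj_of_attached_drop [Finite V] {R : Set V} {v w : V} (hw : w ∉ R)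
    (h3 : 3 ≤ (attached G R v).ncard) (h2 : (attached G (insert w R) v).ncard = 2) :
    G.Adj v w ∧ (attached G R v).ncard = 3 ∧ ∃ p q, G.Adj v p ∧ G.Adj v q ∧ p ∉ R ∧ q ∉ R ∧
      ¬ (isolate G (insert v R)).Reachable p q ∧ ¬ (isolate G (insert v R)).Reachable p w ∧
      ¬ (isolate G (insert v R)).Reachable q w := by
  have hle : isolate G (insert v (insert w R)) ≤ isolate G (insert v R) :=
    isolate_anti (Set.insert_subset_insert (Set.subset_insert _ _))
  set f : (isolate G (insert v (insert w R))).ConnectedComponent →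
    (isolate G (insert v R)).ConnectedComponent := fun C => C.map (SimpleGraph.Hom.ofLE hle)
  have himg : (f '' attached G (insert w R) v).ncard ≤ 2 := h2 ▸ Set.ncard_image_le
  have hmem : ∀ u, G.Adj v u → u ∉ R → u ≠ w →
      (isolate G (insert v R)).connectedComponentMk u ∈ f '' attached G (insert w R) v := by
    intro u hu huR huw
    refine ⟨_, ⟨u, ⟨hu, ?_⟩, rfl⟩, rfl⟩
    rintro (h | h)
    exacts [huw h, huR h]
  have hadj : G.Adj v w := by
    by_contra hvw
    have : attached G R v ⊆ f '' attached G (insert w R) v := by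
      rintro _ ⟨u, hu, rfl⟩
      exact hmem u hu.1 hu.2 (fun h => hvw (h ▸ hu.1))
    have := Set.ncard_le_ncard this
    omega
  have hsub : attached G R v ⊆ insert ((isolate G (insert v R)).connectedComponentMk w)
      (f '' attached G (insert w R) v) := by
    rintro _ ⟨u, hu, rfl⟩
    by_cases huw : u = w
    · exact Or.inl (huw ▸ rfl)
    · exact Or.inr (hmem u hu.1 hu.2 huw)
  have hle3 := (Set.ncard_le_ncard hsub).trans (Set.ncard_insert_le _ _)
  have hmemw : (isolate G (insert v R)).connectedComponentMk w ∈ attached G R v :=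
    ⟨w, ⟨hadj, hw⟩, rfl⟩
  have hd := Set.ncard_sdiff_singleton_add_one hmemw
  have h1 : 1 < (attached G R v \ {(isolate G (insert v R)).connectedComponentMk w}).ncard := by
    omega
  rw [Set.one_lt_ncard_iff] at h1
  obtain ⟨_, _, ⟨⟨p, hp, rfl⟩, hpw⟩, ⟨⟨q, hq, rfl⟩, hqw⟩, hpq⟩ := h1
  exact ⟨hadj, by omega, p, q, hp.1, hq.1, hp.2, hq.2,
    fun h => hpq (SimpleGraph.ConnectedComponent.sound h),
    fun h => hpw (SimpleGraph.ConnectedComponent.sound h),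
    fun h => hqw (SimpleGraph.ConnectedComponent.sound h)⟩

/-- The contradiction is a cut set N for which N ∪ {v} leaves too many components. N is the boundary
of a connected set K that contains v and w, and v separates p, q and w inside K. -/
lemma IsUnmixed.false_of_bridge [Finite V] (hG : IsUnmixed G) (c : G.Coloring (Fin 2))
    {R : Set V} {v w r p q : V} (hv : v ∉ R) (hw : w ∉ R) (hadj : G.Adj v w) (hr : r ∈ R)
    (hcr : c r = c v) (hwR : IsCutSet G (insert w R)) (hQ : IsCutSet G (R \ {r}))
    (hrD : ∀ a b, G.Adj r a → G.Adj r b → a ∉ R → b ∉ R → (isolate G R).Reachable a b)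
    (hp : G.Adj v p) (hq : G.Adj v q) (hpR : p ∉ R) (hqR : q ∉ R)
    (hpq : ¬ (isolate G (insert v R)).Reachable p q)
    (hpw : ¬ (isolate G (insert v R)).Reachable p w)
    (hqw : ¬ (isolate G (insert v R)).Reachable q w) : False := by
  have hcvw := c.valid hadj
  -- The vertex r sees two components of G - (R ∪ {w}) but only one of G - R. One of the two misses
  -- v, and it is joined to the other only through w.
  obtain ⟨b, hrb, hbS, hbv, hbw⟩ : ∃ b, G.Adj r b ∧ b ∉ insert w R ∧
      ¬ (isolate G (insert w R)).Reachable b v ∧ (isolate G R).Reachable b w := by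
    obtain ⟨y, z, hy, hz, hyS, hzS, hyz⟩ := isCutSet_iff.1 hwR r (Or.inr hr)
    have hyR : y ∉ R := fun h => hyS (Or.inr h)
    have hzR : z ∉ R := fun h => hzS (Or.inr h)
    by_cases hyv : (isolate G (insert w R)).Reachable y v
    · refine ⟨z, hz, hzS, fun h => hyz (hyv.trans h.symm), ?_⟩
      by_contra h
      exact hyz (isolate_reachable_insert (hrD z y hz hy hzR hyR) h).symm
    · refine ⟨y, hy, hyS, hyv, ?_⟩
      by_contra h
      exact hyz (isolate_reachable_insert (hrD y z hy hz hyR hzR) h)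
  have hcb : c b = c w := by
    have := c.valid hrb
    omega
  -- C is the component of b in G - (R ∪ {w}), K that of w in G - (R ∪ C), and N the boundary of K.
  -- A boundary vertex in C must be a neighbour of w, so vertices of C with the colour of w, such as
  -- b, avoid N.
  set C : Set V := {x | (isolate G (insert w R)).Reachable b x} with hC
  set K : Set V := {x | (isolate G (R ∪ C)).Reachable w x} with hK
  set N : Set V := {x | x ∉ K ∧ ∃ u ∈ K, G.Adj u x} with hN
  have hCS : ∀ x ∈ C, x ∉ insert w R := fun x hx => notMem_of_isolate_reachable hbS hx
  have hwC : w ∉ C := fun h => hCS w h (Or.inl rfl)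
  have hwK : w ∈ K := SimpleGraph.Reachable.rfl
  have hKS : ∀ x ∈ K, x ∉ R ∪ C := fun x hx =>
    notMem_of_isolate_reachable (by rintro (h | h); exacts [hw h, hwC h]) hx
  have hKstep : ∀ x ∈ K, ∀ y, G.Adj x y → y ∉ R ∪ C → y ∈ K := fun x hx y hxy hy =>
    SimpleGraph.Reachable.trans hx (SimpleGraph.Adj.reachable (G := isolate G (R ∪ C))
      ⟨hxy, hKS x hx, hy⟩)
  have hNS : ∀ x ∈ N, x ∈ R ∪ C := by
    rintro x ⟨hxK, u, hu, hux⟩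
    by_contra h
    exact hxK (hKstep u hu x hux h)
  have hNw : ∀ x ∈ N, x ∈ C → G.Adj w x := by
    rintro x ⟨hxK, u, hu, hux⟩ hxC
    by_cases huw : u = w
    · exact huw ▸ hux
    · refine absurd (Or.inr ?_) (hKS u hu)
      refine SimpleGraph.Reachable.trans hxC (SimpleGraph.Adj.reachable
        (G := isolate G (insert w R)) ⟨hux.symm, hCS x hxC, ?_⟩)
      rintro (h | h)
      exacts [huw h, hKS u hu (Or.inl h)]
  have hCN : ∀ x ∈ C, c x = c w → x ∉ N := fun x hx hcx hxN => c.valid (hNw x hxN hx) hcx.symm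
  have hCK : ∀ x ∈ C, x ∉ K := fun x hx hxK => hKS x hxK (Or.inr hx)
  have hout : ∀ x ∈ N, ∃ y, G.Adj x y ∧ y ∉ N ∧ y ∉ K := by
    intro x hx
    by_cases hxr : x = r
    · subst hxr
      exact ⟨b, hrb, hCN b .rfl hcb, hCK b .rfl⟩
    rcases hNS x hx with hxR | hxC
    -- As R \ {r} is a cut set, x has a neighbour outside the component of w in G - (R \ {r}). That
    -- component contains r, C and K.
    · obtain ⟨y, hxy, hyQ, hyw⟩ : ∃ y, G.Adj x y ∧ y ∉ R \ {r} ∧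
          ¬ (isolate G (R \ {r})).Reachable w y := by
        obtain ⟨y, z, hy, hz, hyS, hzS, hyz⟩ := isCutSet_iff.1 hQ x ⟨hxR, hxr⟩
        by_cases h : (isolate G (R \ {r})).Reachable w y
        · exact ⟨z, hz, hzS, fun h' => hyz (h.symm.trans h')⟩
        · exact ⟨y, hy, hyS, h⟩
      have hbw' : (isolate G (R \ {r})).Reachable w b :=
        (hbw.mono (isolate_anti Set.sdiff_subset)).symm
      refine ⟨y, hxy, fun hyN => ?_, fun hyK => ?_⟩
      · rcases hNS y hyN with hyR | hyC
        · have hyr : y = r := by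
            by_contra h
            exact hyQ ⟨hyR, h⟩
          subst hyr
          refine hyw (hbw'.trans (SimpleGraph.Adj.reachable (G := isolate G (R \ {y}))
            ⟨hrb.symm, fun h => hbS (Or.inr h.1), hyQ⟩))
        · exact hyw (hbw'.trans (SimpleGraph.Reachable.mono
            (isolate_anti (Set.sdiff_subset.trans (Set.subset_insert _ _))) hyC))
      · exact hyw (SimpleGraph.Reachable.mono
          (isolate_anti (Set.sdiff_subset.trans Set.subset_union_left)) hyK)
    · have hwx := c.valid (hNw x hx hxC)
      have hxb : x ≠ b := by
        rintro rfl
        exact hwx hcb.symm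
      -- The next vertex towards b lies in C and has the colour of w, hence is not in N.
      obtain ⟨y, hxy, hyb⟩ : ∃ y, (isolate G (insert w R)).Adj x y ∧
          (isolate G (insert w R)).Reachable b y := by
        have h := SimpleGraph.Reachable.symm hxC
        rw [SimpleGraph.reachable_iff_reflTransGen] at h
        rcases Relation.ReflTransGen.cases_head h with h | ⟨y, h1, h2⟩
        · exact absurd h hxb
        · exact ⟨y, h1, ((SimpleGraph.reachable_iff_reflTransGen _ _).2 h2).symm⟩
      have hcxy := c.valid hxy.1
      exact ⟨y, hxy.1, hCN y hyb (by omega), hCK y hyb⟩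
  have hNcut : IsCutSet G N := by
    rw [isCutSet_iff]
    intro x hx
    obtain ⟨y, hxy, hyN, hyK⟩ := hout x hx
    obtain ⟨-, u, hu, hux⟩ := id hx
    refine ⟨u, y, hux.symm, hxy, fun h => h.1 hu, hyN, fun h => hyK ?_⟩
    refine (reachable_of_closed (H' := ⊤) (K := K) (fun a ha d had => ⟨?_, had.ne⟩) hu h).1
    by_contra hd
    exact had.2.2 ⟨hd, a, ha, had.1⟩
  have hvC : v ∉ C := hbv
  have hvK : v ∈ K := hKstep w hwK v hadj.symm (by rintro (h | h); exacts [hv h, hvC h])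
  have hnbr : ∀ x, G.Adj v x → x ∉ R → x ∈ K := by
    intro x hvx hxR
    refine hKstep v hvK x hvx ?_
    rintro (h | h)
    · exact hxR h
    · refine hvC (SimpleGraph.Reachable.trans h (SimpleGraph.Adj.reachable
        (G := isolate G (insert w R)) ⟨hvx.symm, hCS x h, ?_⟩))
      rintro (h | h)
      exacts [hadj.ne h, hv h]
  have htrans : ∀ x y, x ∈ K → (isolate G (insert v N)).Reachable x y →
      (isolate G (insert v R)).Reachable x y := by
    intro x y hx hxy
    refine (reachable_of_closed (K := K) (fun a ha d had => ?_) hx hxy).2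
    have hd : d ∈ K := by
      by_contra hd
      exact had.2.2 (Or.inr ⟨hd, a, ha, had.1⟩)
    refine ⟨hd, had.1, ?_, ?_⟩
    · rintro (h | h)
      exacts [had.2.1 (Or.inl h), hKS a ha (Or.inl h)]
    · rintro (h | h)
      exacts [had.2.2 (Or.inl h), hKS d hd (Or.inl h)]
  have hKN : ∀ x ∈ K, x ∉ N := fun x hx h => h.1 hx
  have hpK := hnbr p hp hpR
  have hqK := hnbr q hq hqR
  have h3 := three_le_attached hp hq hadj (hKN p hpK) (hKN q hqK) (hKN w hwK)
    (fun h => hpq (htrans _ _ hpK h)) (fun h => hpw (htrans _ _ hpK h))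
    (fun h => hqw (htrans _ _ hqK h))
  -- Three attached components give at least |N| + 3 components after deleting N ∪ {v}, against the
  -- bound |N| + 2.
  have h1 := numComponents_insert (G := G) (hKN v hvK)
  have h2 := hG.numComponents_le (insert v N)
  rw [Set.ncard_insert_of_notMem (hKN v hvK)] at h2
  have h4 := hG N hNcut
  omega

/-- In a bipartite graph whose cut sets satisfy the unmixedness condition, if adding either or both
of two vertices to `R` gives a cut set, then `R` is a cut set. -/
theorem IsUnmixed.isCutSet_of_insert [Finite V] (hG : IsUnmixed G) (hbip : G.IsBipartite)
    {R : Set V} {v w : V} (hvw : v ≠ w) (hv : v ∉ R) (hw : w ∉ R)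
    (h1 : IsCutSet G (insert v R)) (h2 : IsCutSet G (insert w R))
    (h3 : IsCutSet G (insert v (insert w R))) : IsCutSet G R := by
  obtain ⟨c⟩ := hbip
  by_contra hR
  have hcR : numComponents G R ≤ R.ncard := by
    by_contra h
    exact hR (hG.isCutSet (by omega))
  have hvw' : v ∉ insert w R := by rintro (h | h); exacts [hvw h, hv h]
  have hwv' : w ∉ insert v R := by rintro (h | h); exacts [hvw h.symm, hw h]
  have e1 := hG _ h1
  have e2 := hG _ h2
  have e3 := hG _ h3
  rw [Set.ncard_insert_of_notMem hv] at e1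
  rw [Set.ncard_insert_of_notMem hvw', Set.ncard_insert_of_notMem hw] at e3
  rw [Set.ncard_insert_of_notMem hw] at e2
  have n1 := numComponents_insert (G := G) hv
  have n2 := numComponents_insert (G := G) hw
  have n3 := numComponents_insert (G := G) hvw'
  have n4 := numComponents_insert (G := G) hwv'
  have e4 := Set.insert_comm w v R ▸ e3
  -- With c(R) ≤ |R|, the counts force v to meet at least three components over R but exactly two
  -- over R ∪ {w}, and symmetrically for w.
  obtain ⟨hadj, hd, p, q, hp, hq, hpR, hqR, hpq, hpw, hqw⟩ :=
    adj_of_attached_drop (G := G) (v := v) hw (by omega) (by omega)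
  obtain ⟨-, -, p', q', hp', hq', hpR', hqR', hpq', hpv, hqv⟩ :=
    adj_of_attached_drop (G := G) (v := w) hv (by omega) (by omega)
  simp only [IsCutSet, not_forall] at hR
  obtain ⟨r, hr, hlt⟩ := hR
  -- Exactly three attached components means c(R) = |R|, and putting r back does not lower this.
  have hQ : IsCutSet G (R \ {r}) := hG.isCutSet (by
    have := Set.ncard_sdiff_singleton_add_one hr
    omega)
  have hrD : ∀ a b, G.Adj r a → G.Adj r b → a ∉ R → b ∉ R → (isolate G R).Reachable a b := by
    intro a b ha hb haR hbR
    by_contra h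
    exact hlt ((lt_numComponents_iff hr).2 ⟨a, b, ha, hb, haR, hbR, h⟩)
  have hc := c.valid hadj
  have : c r = c v ∨ c r = c w := by omega
  rcases this with h | h
  · exact hG.false_of_bridge c hv hw hadj hr h h2 hQ hrD hp hq hpR hqR hpq hpw hqw
  · exact hG.false_of_bridge c hw hv hadj.symm hr h h1 hQ hrD hp' hq' hpR' hqR' hpq' hpv hqv

/-- The sets that can be built from the empty set by adding vertices one at a time in such a way
that all intermediate sets are cut sets. -/
inductive UpReachable (G : SimpleGraph V) : Set V → Prop
  | empty : UpReachable G ∅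
  | add_vertex {S : Set V} {v : V} : UpReachable G S → v ∉ S → IsCutSet G (insert v S) →
      UpReachable G (insert v S)

lemma UpReachable.isCutSet {S : Set V} (h : UpReachable G S) : IsCutSet G S := by
  cases h with
  | empty => exact isCutSet_empty
  | add_vertex _ _ h => exact h

/-- Induction on the construction of S ∪ {w}. If its last vertex v is not w, the diamond property at
S \ {v} lets v be added after removing w from the earlier stage. -/
lemma UpReachable.of_insert [Finite V] (hG : IsUnmixed G) (hbip : G.IsBipartite) {S : Set V}
    {w : V} (h : UpReachable G (insert w S)) (hw : w ∉ S) (hS : IsCutSet G S) :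
    UpReachable G S := by
  generalize hT : insert w S = T at h
  induction h generalizing S with
  | empty => exact absurd hT (Set.insert_nonempty _ _).ne_empty
  | @add_vertex S' v hS' hv hcut ih =>
    by_cases hvw : v = w
    · subst hvw
      have : S = S' := by
        rw [← Set.insert_sdiff_self_of_notMem hw, hT, Set.insert_sdiff_self_of_notMem hv]
      exact this ▸ hS'
    · have hwS' : w ∈ S' := by
        have : w ∈ insert v S' := hT ▸ Set.mem_insert w S
        exact this.resolve_left (Ne.symm hvw)
      have hvS : v ∈ S := by
        have : v ∈ insert w S := hT ▸ Set.mem_insert v S'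
        exact this.resolve_left hvw
      set R := S \ {v}
      have hvR : v ∉ R := by simp [R]
      have hwR : w ∉ R := fun h => hw h.1
      have e1 : insert v R = S := by simp [R, Set.insert_eq_of_mem hvS]
      have e2 : insert w R = S' := by
        rw [← Set.insert_sdiff_self_of_notMem hv, ← hT, ← e1, Set.insert_comm,
          Set.insert_sdiff_self_of_notMem]
        rintro (h | h)
        exacts [hvw h, hvR h]
      have hRcut : IsCutSet G R := hG.isCutSet_of_insert hbip hvw hvR hwR (e1.symm ▸ hS)
        (e2.symm ▸ hS'.isCutSet) (e2.symm ▸ hcut)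
      have := UpReachable.add_vertex (ih hwR hRcut e2) hvR (e1.symm ▸ hS)
      rwa [e1] at this

end Diamond

/-! ### Prime ideals of partial labellings and their heights. -/

section Algebra

open MvPolynomial

variable (K : Type*) [Field K] {V ι : Type*}

/-- The generic point of the variety attached to a partial labelling of the vertices: vertices
without label are sent to zero, and vertices with the same label to multiples of the same vector. -/
noncomputable def labelHom (c : V → Option ι) :
    MvPolynomial (V ⊕ V) K →ₐ[K] MvPolynomial (V ⊕ (ι ⊕ ι)) K :=
  aeval (Sum.elim
    (fun v => (c v).elim 0 fun i => X (Sum.inl v) * X (Sum.inr (Sum.inl i)))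
    (fun v => (c v).elim 0 fun i => X (Sum.inl v) * X (Sum.inr (Sum.inr i))))

/-- The prime ideal of a partial labelling of the vertices. -/
noncomputable def labelIdeal (c : V → Option ι) : Ideal (MvPolynomial (V ⊕ V) K) :=
  RingHom.ker (labelHom K c)

instance (c : V → Option ι) : (labelIdeal K c).IsPrime := RingHom.ker_isPrime _

/-- The minor of the columns `u` and `v` of the generic matrix. -/
noncomputable def minor (u v : V) : MvPolynomial (V ⊕ V) K :=
  X (Sum.inl u) * X (Sum.inr v) - X (Sum.inl v) * X (Sum.inr u)

variable {K} {c : V → Option ι}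

lemma X_inl_mem_labelIdeal {v : V} : X (Sum.inl v) ∈ labelIdeal K c ↔ c v = none := by
  rw [labelIdeal, RingHom.mem_ker, labelHom, aeval_X]
  cases h : c v <;> simp [h]

lemma X_inr_mem_labelIdeal {v : V} : X (Sum.inr v) ∈ labelIdeal K c ↔ c v = none := by
  rw [labelIdeal, RingHom.mem_ker, labelHom, aeval_X]
  cases h : c v <;> simp [h]

lemma minor_mem_labelIdeal {u v : V} :
    minor K u v ∈ labelIdeal K c ↔ c u = none ∨ c v = none ∨ c u = c v := by
  classical
  rw [labelIdeal, RingHom.mem_ker, labelHom, minor]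
  simp only [map_sub, map_mul, aeval_X, Sum.elim_inl, Sum.elim_inr]
  cases hu : c u with
  | none => simp
  | some i =>
    cases hv : c v with
    | none => simp
    | some j =>
      simp only [Option.elim_some, reduceCtorEq, Option.some.injEq, false_or]
      constructor
      · intro h
        by_contra hij
        -- At the point whose vectors for the labels i and j are (1, 0) and (0, 1), the minor takes
        -- the value 1.
        have := congrArg (eval (Sum.elim (fun _ => (1 : K)) (Sum.elim
          (fun l => if l = i then 1 else 0) (fun l => if l = j then 1 else 0)))) h
        simp [hij, Ne.symm hij] at this
      · rintro rfl
        ring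

/-- Over the fraction field of the quotient by p, the columns of each class are multiples of one
vector, so the quotient map factors through the generic point. -/
lemma labelIdeal_le {p : Ideal (MvPolynomial (V ⊕ V) K)} [p.IsPrime]
    (h0 : ∀ v, c v = none → X (Sum.inl v) ∈ p ∧ X (Sum.inr v) ∈ p)
    (h1 : ∀ u v i, c u = some i → c v = some i → minor K u v ∈ p) : labelIdeal K c ≤ p := by
  classical
  set L := FractionRing (MvPolynomial (V ⊕ V) K ⧸ p)
  set g : MvPolynomial (V ⊕ V) K →ₐ[K] L :=
    (IsScalarTower.toAlgHom K (MvPolynomial (V ⊕ V) K ⧸ p) L).comp (Ideal.Quotient.mkₐ K p)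
  have hg : ∀ f, g f = 0 ↔ f ∈ p := by
    intro f
    simp only [g, AlgHom.comp_apply, IsScalarTower.coe_toAlgHom', Ideal.Quotient.mkₐ_eq_mk]
    rw [FaithfulSMul.algebraMap_eq_zero_iff, Ideal.Quotient.eq_zero_iff_mem]
  set x : V → L := fun v => g (X (Sum.inl v))
  set y : V → L := fun v => g (X (Sum.inr v))
  have hxy : ∀ u v i, c u = some i → c v = some i → x u * y v = x v * y u := by
    intro u v i hu hv
    have := (hg _).2 (h1 u v i hu hv)
    rwa [minor, map_sub, map_mul, map_mul, sub_eq_zero] at this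
  -- Any nonzero column of the class serves as the common vector; if there is none, zero does.
  have hab : ∀ i, ∃ a b : L, ∀ v, c v = some i → ∃ t, x v = t * a ∧ y v = t * b := by
    intro i
    by_cases h : ∃ u, c u = some i ∧ (x u ≠ 0 ∨ y u ≠ 0)
    · obtain ⟨u, hu, hu0⟩ := h
      refine ⟨x u, y u, fun v hv => ?_⟩
      have e := hxy u v i hu hv
      rcases hu0 with h | h
      · refine ⟨x v / x u, (div_mul_cancel₀ _ h).symm, ?_⟩
        rw [div_mul_eq_mul_div, eq_div_iff h]
        linear_combination e
      · refine ⟨y v / y u, ?_, (div_mul_cancel₀ _ h).symm⟩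
        rw [div_mul_eq_mul_div, eq_div_iff h]
        linear_combination -e
    · push Not at h
      exact ⟨0, 0, fun v hv => ⟨0, by simp [(h v hv).1], by simp [(h v hv).2]⟩⟩
  choose a b hab using hab
  have ht : ∀ v, ∃ t : L, ∀ i, c v = some i → x v = t * a i ∧ y v = t * b i := by
    intro v
    cases hv : c v with
    | none => exact ⟨0, by simp⟩
    | some i =>
      obtain ⟨t, ht⟩ := hab i v hv
      refine ⟨t, fun j hj => ?_⟩
      cases hj
      exact ht
  choose t ht using ht
  have hfac : (aeval (Sum.elim t (Sum.elim a b))).comp (labelHom K c) = g := by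
    refine MvPolynomial.algHom_ext fun s => ?_
    rw [AlgHom.comp_apply, labelHom, aeval_X]
    rcases s with v | v
    · cases hv : c v with
      | none => simpa [hv] using ((hg _).2 (h0 v hv).1).symm
      | some i => simpa [hv] using (ht v i hv).1.symm
    · cases hv : c v with
      | none => simpa [hv] using ((hg _).2 (h0 v hv).2).symm
      | some i => simpa [hv] using (ht v i hv).2.symm
  intro f hf
  rw [labelIdeal, RingHom.mem_ker] at hf
  rw [← hg, ← hfac, AlgHom.comp_apply, hf, map_zero]

lemma labelIdeal_le_labelIdeal {κ : Type*} {d : V → Option κ} (h0 : ∀ v, c v = none → d v = none)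
    (h1 : ∀ u v i, c u = some i → c v = some i → d u = none ∨ d v = none ∨ d u = d v) :
    labelIdeal K c ≤ labelIdeal K d :=
  labelIdeal_le
    (fun v hv => ⟨X_inl_mem_labelIdeal.2 (h0 v hv), X_inr_mem_labelIdeal.2 (h0 v hv)⟩)
    (fun u v i hu hv => minor_mem_labelIdeal.2 (h1 u v i hu hv))

/-- The number of vertices without label. -/
noncomputable def numNone (c : V → Option ι) : ℕ := {v | c v = none}.ncard

/-- The number of labels that occur. -/
noncomputable def numLabels (c : V → Option ι) : ℕ := {i | ∃ v, c v = some i}.ncard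

/-! ### Elementary moves on labellings: splitting a class and erasing a label. -/

section Split

variable [DecidableEq V] {d : V → Option V} {u v i j : V}

lemma split_lt (huv : u ≠ v) (hu : d u = some i) (hv : d v = some i)
    (hj : ∀ w, d w ≠ some j) :
    labelIdeal K (Function.update d v (some j)) < labelIdeal K d := by
  have hij : i ≠ j := by
    rintro rfl
    exact hj u hu
  refine lt_of_le_of_ne (labelIdeal_le_labelIdeal ?_ ?_) ?_
  · intro w hw
    by_cases h : w = v
    · subst h; simp at hw
    · rwa [Function.update_of_ne h] at hw
  · intro a b l ha hb
    by_cases h1 : a = v <;> by_cases h2 : b = v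
    · subst h1 h2; simp
    · subst h1
      rw [Function.update_of_ne h2] at hb
      rw [Function.update_self] at ha
      exact absurd (hb.trans ha.symm) (hj b)
    · subst h2
      rw [Function.update_of_ne h1] at ha
      rw [Function.update_self] at hb
      exact absurd (ha.trans hb.symm) (hj a)
    · rw [Function.update_of_ne h1] at ha
      rw [Function.update_of_ne h2] at hb
      exact Or.inr (Or.inr (ha.trans hb.symm))
  · intro h
    have h1 : minor K u v ∈ labelIdeal K d := minor_mem_labelIdeal.2 (by simp [hu, hv])
    rw [← h, minor_mem_labelIdeal, Function.update_self, Function.update_of_ne huv, hu] at h1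
    simp [hij] at h1

lemma numLabels_split [Finite V] (huv : u ≠ v) (hu : d u = some i) (hv : d v = some i)
    (hj : ∀ w, d w ≠ some j) :
    numLabels (Function.update d v (some j)) = numLabels d + 1 := by
  rw [numLabels, numLabels, ← Set.ncard_insert_of_notMem (a := j)]
  · congr 1
    ext l
    simp only [Set.mem_ofPred_eq, Set.mem_insert_iff]
    constructor
    · rintro ⟨w, hw⟩
      by_cases h : w = v
      · subst h; simp at hw; exact Or.inl hw.symm
      · rw [Function.update_of_ne h] at hw; exact Or.inr ⟨w, hw⟩
    · rintro (rfl | ⟨w, hw⟩)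
      · exact ⟨v, by simp⟩
      · by_cases h : w = v
        · subst h
          exact ⟨u, by rw [Function.update_of_ne huv, hu, ← hv, hw]⟩
        · exact ⟨w, by rwa [Function.update_of_ne h]⟩
  · rintro ⟨w, hw⟩
    exact hj w hw

lemma numNone_update_some (hv : d v ≠ none) :
    numNone (Function.update d v (some j)) = numNone d := by
  rw [numNone, numNone]
  congr 1
  ext w
  by_cases h : w = v
  · subst h; simpa using hv
  · simp [Function.update_of_ne h]

lemma erase_lt (hv : d v = some i) :
    labelIdeal K d < labelIdeal K (Function.update d v none) := by
  refine lt_of_le_of_ne (labelIdeal_le_labelIdeal ?_ ?_) ?_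
  · intro w hw
    by_cases h : w = v
    · subst h; simp
    · rwa [Function.update_of_ne h]
  · intro a b l ha hb
    by_cases h1 : a = v
    · subst h1; simp
    · by_cases h2 : b = v
      · subst h2; simp
      · simp [Function.update_of_ne h1, Function.update_of_ne h2, ha, hb]
  · intro h
    have h1 : X (Sum.inl v) ∈ labelIdeal K (Function.update d v none) :=
      X_inl_mem_labelIdeal.2 (by simp)
    rw [← h, X_inl_mem_labelIdeal, hv] at h1
    cases h1

lemma numLabels_erase (huv : u ≠ v) (hu : d u = some i) (hv : d v = some i) :
    numLabels (Function.update d v none) = numLabels d := by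
  rw [numLabels, numLabels]
  congr 1
  ext l
  constructor
  · rintro ⟨w, hw⟩
    by_cases h : w = v
    · subst h; simp at hw
    · rw [Function.update_of_ne h] at hw; exact ⟨w, hw⟩
  · rintro ⟨w, hw⟩
    by_cases h : w = v
    · subst h
      exact ⟨u, by rw [Function.update_of_ne huv, hu, ← hv, hw]⟩
    · exact ⟨w, by rwa [Function.update_of_ne h]⟩

lemma numNone_erase [Finite V] (hv : d v ≠ none) :
    numNone (Function.update d v none) = numNone d + 1 := by
  rw [numNone, numNone, ← Set.ncard_insert_of_notMem (a := v) hv]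
  congr 1
  ext w
  by_cases h : w = v
  · subst h; simp
  · simp [h]

end Split

/-- Every prime ideal has height at most the number of variables. -/
lemma height_le_two_mul [Finite V] (p : Ideal (MvPolynomial (V ⊕ V) K)) [p.IsPrime] :
    p.height ≤ ((2 * Nat.card V : ℕ) : ℕ∞) := by
  have h := p.height_le_ringKrullDim_of_isPrime
  rw [MvPolynomial.ringKrullDim_of_isNoetherianRing, ringKrullDim_eq_zero_of_field, zero_add,
    Nat.card_sum, ← two_mul] at h
  refine WithBot.coe_le_coe.1 (h.trans (le_of_eq ?_))
  norm_cast

/-- A descending chain: split a class, or label an unlabelled vertex. Each move gives a strictly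
smaller prime and lowers the expected height by one, until all vertices carry distinct labels and
the bound is zero. -/
lemma le_height_labelIdeal [Finite V] (m : ℕ) (d : V → Option V) (hd : ∃ v, d v ≠ none)
    (hm : numNone d + Nat.card V ≤ numLabels d + m) : numNone d + Nat.card V ≤
      numLabels d + (labelIdeal K d).height := by
  classical
  induction m generalizing d with
  | zero => exact le_add_right (by exact_mod_cast hm)
  | succ m ih =>
    by_cases hsplit : ∃ u v i, u ≠ v ∧ d u = some i ∧ d v = some i
    · obtain ⟨u, v, i, huv, hu, hv⟩ := hsplit
      -- Labels are vertices, so if all were used the labelling would be injective.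
      obtain ⟨j, hj⟩ : ∃ j, ∀ w, d w ≠ some j := by
        by_contra! h
        choose g hg using h
        have hinj : Function.Injective g := fun a b hab => by
          have := hg a
          rw [hab, hg b] at this
          exact (Option.some.inj this).symm
        obtain ⟨a, rfl⟩ := Finite.surjective_of_injective hinj u
        obtain ⟨b, rfl⟩ := Finite.surjective_of_injective hinj v
        rw [hg] at hu hv
        exact huv (by rw [Option.some.inj (hu.trans hv.symm)])
      have h1 := Ideal.height_add_one_le_of_lt_of_isPrime (split_lt (K := K) huv hu hv hj)
      have e1 := numLabels_split huv hu hv hj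
      have e2 := numNone_update_some (d := d) (v := v) (j := j) (by simp [hv])
      have := ih (Function.update d v (some j)) ⟨v, by simp⟩ (by omega)
      rw [e1, e2] at this
      refine this.trans (le_trans (le_of_eq ?_) (add_le_add le_rfl h1))
      push_cast
      ring
    · by_cases hnone : ∃ w, d w = none
      · obtain ⟨w, hw⟩ := hnone
        obtain ⟨u, hu⟩ := hd
        obtain ⟨i, hi⟩ := Option.ne_none_iff_exists'.1 hu
        have huw : u ≠ w := by
          rintro rfl
          exact hu hw
        set d' := Function.update d w (some i) with hd'
        have hu' : d' u = some i := by rw [hd', Function.update_of_ne huw, hi]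
        have hw' : d' w = some i := by simp [d']
        have hback : Function.update d' w none = d := by
          rw [hd', Function.update_idem, ← hw, Function.update_eq_self]
        have h1 := Ideal.height_add_one_le_of_lt_of_isPrime (erase_lt (K := K) hw')
        have e1 := numLabels_erase huw hu' hw'
        have e2 := numNone_erase (d := d') (v := w) (by simp [hw'])
        rw [hback] at h1 e1 e2
        have := ih d' ⟨w, by simp [hw']⟩ (by omega)
        rw [← e1] at this
        rw [e2]
        refine le_trans (le_of_eq ?_) ((add_le_add_left this 1).trans (le_trans (le_of_eq ?_)
          (add_le_add le_rfl h1)))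
        · push_cast
          ring
        · ring
      · push Not at hsplit hnone
        choose f hf using fun v => Option.ne_none_iff_exists'.1 (hnone v)
        have hinj : Function.Injective f := fun a b hab => by
          by_contra h
          exact hsplit a b (f a) h (hf a) (by rw [hf b, hab])
        have e1 : numNone d = 0 := by
          rw [numNone, Set.ncard_eq_zero]
          ext v
          simp [hnone v]
        have e2 : numLabels d = Nat.card V := by
          rw [numLabels, ← Set.ncard_univ]
          congr 1
          ext l
          obtain ⟨v, rfl⟩ := Finite.surjective_of_injective hinj l
          simp only [Set.mem_ofPred_eq, Set.mem_univ, iff_true]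
          exact ⟨v, hf v⟩
        rw [e1, e2]
        simp

/-- Two more strict inclusions: first kill every variable except the first one of v, then kill that
one too. The height of the last prime is at most 2n. -/
lemma height_le_of_unique_label [Finite V] {d : V → Option V} {v : V} (hv : d v ≠ none)
    (huniq : ∀ u, u ≠ v → d u = none) :
    (labelIdeal K d).height + 1 + 1 ≤ ((2 * Nat.card V : ℕ) : ℕ∞) := by
  classical
  obtain ⟨i, hi⟩ := Option.ne_none_iff_exists'.1 hv
  set φ : MvPolynomial (V ⊕ V) K →ₐ[K] Polynomial K :=
    aeval (Sum.elim (fun u => if u = v then Polynomial.X else 0) 0)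
  set q := RingHom.ker φ
  have hqp : q.IsPrime := RingHom.ker_isPrime _
  set m := RingHom.ker (aeval (0 : V ⊕ V → K) : MvPolynomial (V ⊕ V) K →ₐ[K] K)
  have hmp : m.IsPrime := RingHom.ker_isPrime _
  have h1 : labelIdeal K d < q := by
    refine lt_of_le_of_ne (labelIdeal_le ?_ ?_) ?_
    · intro u hu
      have huv : u ≠ v := by
        rintro rfl
        exact hv hu
      constructor <;> simp [q, φ, RingHom.mem_ker, huv]
    · intro a b l ha hb
      simp [q, φ, RingHom.mem_ker, minor]
    · intro h
      have : X (Sum.inr v) ∈ labelIdeal K d := by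
        rw [h]
        simp [q, φ, RingHom.mem_ker]
      exact hv (X_inr_mem_labelIdeal.1 this)
  have h2 : q < m := by
    refine lt_of_le_of_ne ?_ ?_
    · have : (Polynomial.aeval (0 : K)).comp φ =
          (aeval (0 : V ⊕ V → K) : MvPolynomial (V ⊕ V) K →ₐ[K] K) := by
        refine MvPolynomial.algHom_ext fun s => ?_
        rcases s with u | u
        · by_cases h : u = v <;> simp [φ, h]
        · simp [φ]
      intro f hf
      rw [RingHom.mem_ker] at hf ⊢
      rw [← this, AlgHom.comp_apply, hf, map_zero]
    · intro h
      have : X (Sum.inl v) ∈ m := by simp [m, RingHom.mem_ker]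
      rw [← h] at this
      simp [q, φ, RingHom.mem_ker] at this
  exact (add_le_add_left (Ideal.height_add_one_le_of_lt_of_isPrime h1) 1).trans
    ((Ideal.height_add_one_le_of_lt_of_isPrime h2).trans (height_le_two_mul m))

/-- An ascending chain: merge two labels, or erase one of several vertices sharing a label, until a
single labelled vertex is left. -/
lemma height_labelIdeal_add_le [Finite V] (m : ℕ) (d : V → Option V) (hd : ∃ v, d v ≠ none)
    (hm : numLabels d + Nat.card V = numNone d + m) :
    (labelIdeal K d).height + m ≤ ((2 * Nat.card V : ℕ) : ℕ∞) := by
  classical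
  induction m generalizing d with
  | zero => simpa using height_le_two_mul (labelIdeal K d)
  | succ m ih =>
    by_cases hmerge : ∃ u v i j, d u = some i ∧ d v = some j ∧ i ≠ j
    · obtain ⟨u, v, i, j, hu, hv, hij⟩ := hmerge
      set d' : V → Option V := fun w => if d w = some j then some i else d w
      have hdu : d' u = some i := by simp [d', hu]
      have hdv : d' v = some i := by simp [d', hv]
      have hlt : labelIdeal K d < labelIdeal K d' := by
        refine lt_of_le_of_ne (labelIdeal_le_labelIdeal ?_ ?_) ?_
        · intro w hw
          simp [d', hw]
        · intro a b l ha hb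
          simp [d', ha, hb]
        · intro h
          have h1 : minor K u v ∈ labelIdeal K d' := minor_mem_labelIdeal.2 (by simp [hdu, hdv])
          rw [← h, minor_mem_labelIdeal, hu, hv] at h1
          simp [hij] at h1
      have e1 : numNone d' = numNone d := by
        rw [numNone, numNone]
        congr 1
        ext w
        by_cases h : d w = some j <;> simp [d', h]
      have e2 : numLabels d' + 1 = numLabels d := by
        rw [numLabels, numLabels, ← Set.ncard_sdiff_singleton_add_one
          (show j ∈ {l | ∃ w, d w = some l} from ⟨v, hv⟩)]
        congr 2
        ext l
        constructor
        · rintro ⟨w, hw⟩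
          by_cases h : d w = some j
          · simp only [d', h, if_true, Option.some.injEq] at hw
            subst hw
            exact ⟨⟨u, hu⟩, hij⟩
          · simp only [d', h, if_false] at hw
            refine ⟨⟨w, hw⟩, ?_⟩
            rintro rfl
            exact h hw
        · rintro ⟨⟨w, hw⟩, hl⟩
          refine ⟨w, ?_⟩
          have : l ≠ j := hl
          simp [d', hw, this]
      have := ih d' ⟨u, by simp [hdu]⟩ (by omega)
      have h1 := Ideal.height_add_one_le_of_lt_of_isPrime hlt
      refine le_trans (le_of_eq ?_) ((add_le_add_left h1 (m : ℕ∞)).trans this)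
      push_cast
      ring
    · push Not at hmerge
      obtain ⟨v, hv⟩ := hd
      obtain ⟨i, hi⟩ := Option.ne_none_iff_exists'.1 hv
      by_cases h2 : ∃ u, u ≠ v ∧ d u ≠ none
      · obtain ⟨u, huv, hu⟩ := h2
        obtain ⟨j, hj⟩ := Option.ne_none_iff_exists'.1 hu
        obtain rfl := hmerge u v j i hj hi
        have h1 := Ideal.height_add_one_le_of_lt_of_isPrime (erase_lt (K := K) hi)
        have e1 := numLabels_erase huv hj hi
        have e2 := numNone_erase (d := d) (v := v) hv
        have := ih (Function.update d v none) ⟨u, by simp [Function.update_of_ne huv, hj]⟩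
          (by omega)
        refine le_trans (le_of_eq ?_) ((add_le_add_left h1 (m : ℕ∞)).trans this)
        push_cast
        ring
      · push Not at h2
        have e1 : numLabels d = 1 := by
          rw [numLabels, Set.ncard_eq_one]
          refine ⟨i, Set.ext fun l => ⟨?_, ?_⟩⟩
          · rintro ⟨w, hw⟩
            exact hmerge w v l i hw hi
          · rintro rfl
            exact ⟨v, hi⟩
        have e2 : numNone d + 1 = Nat.card V := by
          rw [numNone, ← Set.ncard_univ, ← Set.ncard_sdiff_singleton_add_one (Set.mem_univ v)]
          congr 2
          ext w
          simp only [Set.mem_ofPred_eq, Set.mem_sdiff, Set.mem_univ, Set.mem_singleton_iff, true_and]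
          constructor
          · rintro h rfl
            exact hv h
          · exact h2 w
        have hm' : m = 1 := by omega
        subst hm'
        have := height_le_of_unique_label (K := K) hv h2
        rwa [add_assoc] at this

/-- The height of the prime ideal of a partial labelling. -/
theorem height_labelIdeal [Finite V] (d : V → Option V) (hd : ∃ v, d v ≠ none) :
    (labelIdeal K d).height + numLabels d = ((numNone d + Nat.card V : ℕ) : ℕ∞) := by
  have hle : numNone d ≤ Nat.card V := by
    rw [numNone, ← Set.ncard_univ]
    exact Set.ncard_le_ncard (Set.subset_univ _)
  have h1 := le_height_labelIdeal (K := K) (numNone d + Nat.card V) d hd (by omega)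
  have h2 := height_labelIdeal_add_le (K := K) (numLabels d + Nat.card V - numNone d) d hd
    (by omega)
  have h3 : (labelIdeal K d).height ≠ ⊤ :=
    ne_top_of_le_ne_top (ENat.natCast_ne_top _) (height_le_two_mul _)
  lift (labelIdeal K d).height to ℕ using h3 with k
  norm_cast at h1 h2 ⊢
  omega

end Algebra

/-! ### Minimal primes as cut sets, and unmixedness. -/

section MinimalPrimes

open MvPolynomial

variable {K : Type*} [Field K] {V : Type*}

/-- The vertices of which both variables lie in `p`. -/
def zeroSet (p : Ideal (MvPolynomial (V ⊕ V) K)) : Set V :=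
  {v | X (Sum.inl v) ∈ p ∧ X (Sum.inr v) ∈ p}

lemma minor_mem_comm {p : Ideal (MvPolynomial (V ⊕ V) K)} {u v : V} (h : minor K u v ∈ p) :
    minor K v u ∈ p := by
  have : minor K v u = -minor K u v := by
    rw [minor, minor]
    ring
  rw [this]
  exact neg_mem h

/-- By the Plücker relation, either coordinate of column v times the minor of u and w is a
combination of the other two minors. -/
lemma minor_mem_trans {p : Ideal (MvPolynomial (V ⊕ V) K)} [hp : p.IsPrime] {u v w : V}
    (hv : v ∉ zeroSet p) (h1 : minor K u v ∈ p) (h2 : minor K v w ∈ p) : minor K u w ∈ p := by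
  by_contra h
  refine hv ⟨(hp.mem_or_mem ?_).resolve_right h, (hp.mem_or_mem ?_).resolve_right h⟩
  · have : X (Sum.inl v) * minor K u w =
        X (Sum.inl u) * minor K v w + X (Sum.inl w) * minor K u v := by
      simp only [minor]
      ring
    rw [this]
    exact add_mem (p.mul_mem_left _ h2) (p.mul_mem_left _ h1)
  · have : X (Sum.inr v) * minor K u w =
        X (Sum.inr u) * minor K v w + X (Sum.inr w) * minor K u v := by
      simp only [minor]
      ring
    rw [this]
    exact add_mem (p.mul_mem_left _ h2) (p.mul_mem_left _ h1)

lemma minor_self_mem (p : Ideal (MvPolynomial (V ⊕ V) K)) (u : V) : minor K u u ∈ p := by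
  rw [minor, sub_self]
  exact zero_mem p

open Classical in
/-- The labelling of the vertices outside `S` by the components of the graph without `S`. -/
noncomputable def componentLabel (G : SimpleGraph V) (S : Set V) (v : V) : Option V :=
  if v ∈ S then none else some (Quot.out ((isolate G S).connectedComponentMk v))

variable {G : SimpleGraph V}

lemma componentLabel_eq_none {S : Set V} {v : V} : componentLabel G S v = none ↔ v ∈ S := by
  simp [componentLabel]

lemma quotOut_injective (H : SimpleGraph V) :
    Function.Injective (Quot.out : H.ConnectedComponent → V) :=
  Function.LeftInverse.injective (g := H.connectedComponentMk) Quot.out_eq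

lemma componentLabel_eq {S : Set V} {u v : V} (hu : u ∉ S) (hv : v ∉ S) :
    componentLabel G S u = componentLabel G S v ↔ (isolate G S).Reachable u v := by
  rw [componentLabel, componentLabel, if_neg hu, if_neg hv, Option.some_inj]
  constructor
  · intro h
    exact SimpleGraph.ConnectedComponent.exact (quotOut_injective _ h)
  · intro h
    rw [SimpleGraph.ConnectedComponent.sound h]

lemma numNone_componentLabel (S : Set V) : numNone (componentLabel G S) = S.ncard := by
  rw [numNone]
  congr 1
  ext v
  exact componentLabel_eq_none

lemma numLabels_componentLabel (S : Set V) :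
    numLabels (componentLabel G S) = numComponents G S := by
  have himg := Set.ncard_image_of_injective ((isolate G S).connectedComponentMk '' Sᶜ)
    (quotOut_injective (isolate G S))
  rw [numComponents_eq_ncard, ← himg, numLabels]
  congr 1
  ext i
  constructor
  · rintro ⟨v, hv⟩
    by_cases h : v ∈ S
    · simp [componentLabel, h] at hv
    · rw [componentLabel, if_neg h] at hv
      exact ⟨_, ⟨v, h, rfl⟩, Option.some_inj.1 hv⟩
  · rintro ⟨_, ⟨v, h, rfl⟩, rfl⟩
    exact ⟨v, by rw [componentLabel, if_neg h]⟩

variable (K G) in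
/-- The prime ideal of a set `S` of vertices: the variables of `S` vanish, and the columns of any two
vertices in the same component of the graph without `S` are proportional. -/
noncomputable def cutIdeal (S : Set V) : Ideal (MvPolynomial (V ⊕ V) K) :=
  labelIdeal K (componentLabel G S)

instance (S : Set V) : (cutIdeal K G S).IsPrime :=
  inferInstanceAs (labelIdeal K (componentLabel G S)).IsPrime

lemma zeroSet_cutIdeal (S : Set V) : zeroSet (cutIdeal K G S) = S := by
  ext v
  change _ ∧ _ ↔ _
  rw [cutIdeal, X_inl_mem_labelIdeal, X_inr_mem_labelIdeal, componentLabel_eq_none, and_self]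

lemma minor_mem_cutIdeal {S : Set V} {u v : V} :
    minor K u v ∈ cutIdeal K G S ↔ u ∈ S ∨ v ∈ S ∨ (isolate G S).Reachable u v := by
  rw [cutIdeal, minor_mem_labelIdeal, componentLabel_eq_none, componentLabel_eq_none]
  by_cases hu : u ∈ S
  · simp [hu]
  · by_cases hv : v ∈ S
    · simp [hv]
    · rw [componentLabel_eq hu hv]

lemma zeroSet_mono {p q : Ideal (MvPolynomial (V ⊕ V) K)} (h : p ≤ q) :
    zeroSet p ⊆ zeroSet q := fun _ hv => ⟨h hv.1, h hv.2⟩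

lemma cutIdeal_le {S : Set V} {p : Ideal (MvPolynomial (V ⊕ V) K)} [p.IsPrime]
    (h0 : S ⊆ zeroSet p)
    (h1 : ∀ u v, u ∉ S → v ∉ S → (isolate G S).Reachable u v → minor K u v ∈ p) :
    cutIdeal K G S ≤ p := by
  refine labelIdeal_le (fun v hv => h0 (componentLabel_eq_none.1 hv)) (fun u v i hu hv => ?_)
  have hu' : u ∉ S := fun h => by simp [componentLabel_eq_none.2 h] at hu
  have hv' : v ∉ S := fun h => by simp [componentLabel_eq_none.2 h] at hv
  exact h1 u v hu' hv' ((componentLabel_eq hu' hv').1 (hu.trans hv.symm))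

lemma binomialEdgeIdeal_le_cutIdeal (S : Set V) : binomialEdgeIdeal K G ≤ cutIdeal K G S := by
  rw [binomialEdgeIdeal, Ideal.span_le]
  rintro _ ⟨i, j, hij, rfl⟩
  change minor K i j ∈ cutIdeal K G S
  rw [minor_mem_cutIdeal]
  by_cases hi : i ∈ S
  · exact Or.inl hi
  · by_cases hj : j ∈ S
    · exact Or.inr (Or.inl hj)
    · exact Or.inr (Or.inr (SimpleGraph.Adj.reachable (G := isolate G S) ⟨hij, hi, hj⟩))

lemma cutIdeal_zeroSet_le {p : Ideal (MvPolynomial (V ⊕ V) K)} [p.IsPrime]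
    (hp : binomialEdgeIdeal K G ≤ p) : cutIdeal K G (zeroSet p) ≤ p := by
  refine cutIdeal_le le_rfl fun u v hu _ huv => ?_
  rw [SimpleGraph.reachable_iff_reflTransGen] at huv
  induction huv with
  | refl => exact minor_self_mem p u
  | tail _ hbc ih =>
    exact minor_mem_trans hbc.2.1 (ih hbc.2.1) (hp (Ideal.subset_span ⟨_, _, hbc.1, rfl⟩))

lemma exists_adj_reachable_insert {T : Set V} {u x : V} (hu : u ∉ T) (hux : u ≠ x)
    (h : (isolate G T).Reachable u x) :
    ∃ a, G.Adj x a ∧ a ∉ T ∧ (isolate G (insert x T)).Reachable u a := by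
  by_contra! hcon
  have huS : u ∉ insert x T := by rintro (h | h); exacts [hux h, hu h]
  have := (reachable_of_closed (H' := ⊤)
    (K := {y | (isolate G (insert x T)).Reachable u y}) (fun y hy z hyz => ⟨?_, hyz.ne⟩) .rfl h).1
  · exact notMem_of_isolate_reachable huS this (Set.mem_insert _ _)
  · have hyS := notMem_of_isolate_reachable huS hy
    refine SimpleGraph.Reachable.trans hy (SimpleGraph.Adj.reachable
      (G := isolate G (insert x T)) ⟨hyz.1, hyS, ?_⟩)
    rintro (rfl | h)
    · exact hcon y hyz.1.symm hyz.2.1 hy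
    · exact hyz.2.2 h

lemma numComponents_empty (hconn : G.Connected) : numComponents G ∅ = 1 := by
  rw [numComponents_eq_ncard, Set.ncard_eq_one]
  obtain ⟨v⟩ := hconn.nonempty
  refine ⟨(isolate G ∅).connectedComponentMk v, Set.ext fun C => ⟨?_, ?_⟩⟩
  · rintro ⟨u, -, rfl⟩
    exact SimpleGraph.ConnectedComponent.sound ((hconn.preconnected u v).mono
      fun a b h => ⟨h, id, id⟩)
  · rintro rfl
    exact ⟨v, id, rfl⟩

lemma height_eq_of_dualGraph_connected (hdual : (dualGraph (binomialEdgeIdeal K G)).Connected)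
    (p q : (binomialEdgeIdeal K G).minimalPrimes) :
    (p : Ideal (MvPolynomial (V ⊕ V) K)).height = (q : Ideal (MvPolynomial (V ⊕ V) K)).height := by
  have h := hdual.preconnected p q
  rw [SimpleGraph.reachable_iff_reflTransGen] at h
  induction h with
  | refl => rfl
  | tail _ hbc ih => rw [ih, hbc.2.2.1, hbc.2.2.2]

variable [Finite V]

/-- The cut set is the zero set W. If some x in W saw at most one component of G - W, putting it
back would merge no components, and the prime of W \ {x} would lie strictly below p. -/
lemma exists_isCutSet_of_mem_minimalPrimes {p : Ideal (MvPolynomial (V ⊕ V) K)}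
    (hp : p ∈ (binomialEdgeIdeal K G).minimalPrimes) :
    ∃ S, IsCutSet G S ∧ p = cutIdeal K G S := by
  have hpp : p.IsPrime := hp.1.1
  set W := zeroSet p
  have hpW : p = cutIdeal K G W := le_antisymm
    (hp.2 ⟨inferInstance, binomialEdgeIdeal_le_cutIdeal W⟩ (cutIdeal_zeroSet_le hp.1.2))
    (cutIdeal_zeroSet_le hp.1.2)
  refine ⟨W, ?_, hpW⟩
  rw [isCutSet_iff]
  by_contra! hcon
  obtain ⟨x, hx, hcon⟩ := hcon
  have hins : insert x (W \ {x}) = W := by rw [Set.insert_sdiff_singleton, Set.insert_eq_of_mem hx]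
  have hle : cutIdeal K G (W \ {x}) ≤ cutIdeal K G W := by
    refine cutIdeal_le ((zeroSet_cutIdeal (K := K) (G := G) W).symm ▸ Set.sdiff_subset)
      fun u v hu hv huv => ?_
    rw [minor_mem_cutIdeal]
    by_cases huW : u ∈ W
    · exact Or.inl huW
    by_cases hvW : v ∈ W
    · exact Or.inr (Or.inl hvW)
    refine Or.inr (Or.inr ?_)
    by_cases hux : (isolate G (W \ {x})).Reachable u x
    · have hne : ∀ y, y ∉ W → y ≠ x := fun y hy h => hy (h ▸ hx)
      obtain ⟨a, hxa, ha, hua⟩ := exists_adj_reachable_insert hu (hne u huW) hux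
      obtain ⟨b, hxb, hb, hvb⟩ := exists_adj_reachable_insert hv (hne v hvW) (huv.symm.trans hux)
      rw [hins] at hua hvb
      have haW := notMem_of_isolate_reachable huW hua
      have hbW := notMem_of_isolate_reachable hvW hvb
      exact (hua.trans (hcon a b hxa hxb haW hbW)).trans hvb.symm
    · have := isolate_reachable_insert huv hux
      rwa [hins] at this
  have hge := hp.2 ⟨inferInstance, binomialEdgeIdeal_le_cutIdeal (W \ {x})⟩
    (hle.trans (cutIdeal_zeroSet_le hp.1.2))
  have hxx := zeroSet_mono hge hx
  rw [zeroSet_cutIdeal] at hxx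
  exact hxx.2 rfl

/-- A smaller prime whose zero set misses x in S would contain the minor of two neighbours of x from
different components of G - S, since x joins them. -/
lemma cutIdeal_mem_minimalPrimes {S : Set V} (hS : IsCutSet G S) :
    cutIdeal K G S ∈ (binomialEdgeIdeal K G).minimalPrimes := by
  refine ⟨⟨inferInstance, binomialEdgeIdeal_le_cutIdeal S⟩, ?_⟩
  rintro q ⟨hq, hJq⟩ hqS
  have hWS : zeroSet q ⊆ S := zeroSet_cutIdeal (K := K) (G := G) S ▸ zeroSet_mono hqS
  have hWq := cutIdeal_zeroSet_le hJq
  suffices zeroSet q = S by rwa [this] at hWq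
  refine hWS.antisymm fun x hx => ?_
  by_contra hxW
  obtain ⟨u, w, hu, hw, huS, hwS, huw⟩ := isCutSet_iff.1 hS x hx
  have h1 : (isolate G (zeroSet q)).Adj x u := ⟨hu, hxW, fun h => huS (hWS h)⟩
  have h2 : (isolate G (zeroSet q)).Adj x w := ⟨hw, hxW, fun h => hwS (hWS h)⟩
  have h3 : minor K u w ∈ cutIdeal K G S := hqS (hWq (minor_mem_cutIdeal.2
    (Or.inr (Or.inr (h1.symm.reachable.trans h2.reachable)))))
  rcases minor_mem_cutIdeal.1 h3 with h | h | h
  exacts [huS h, hwS h, huw h]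

lemma height_cutIdeal {S : Set V} (hS : S ≠ Set.univ) :
    (cutIdeal K G S).height + numComponents G S = ((S.ncard + Nat.card V : ℕ) : ℕ∞) := by
  obtain ⟨v, hv⟩ := (Set.ne_univ_iff_exists_notMem S).1 hS
  have := height_labelIdeal (K := K) (componentLabel G S)
    ⟨v, fun h => hv (componentLabel_eq_none.1 h)⟩
  rwa [numNone_componentLabel, numLabels_componentLabel] at this

lemma IsCutSet.ne_univ [Nonempty V] {S : Set V} (hS : IsCutSet G S) : S ≠ Set.univ := by
  rintro rfl
  obtain ⟨v⟩ := ‹Nonempty V›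
  obtain ⟨u, -, -, -, hu, -⟩ := isCutSet_iff.1 hS v trivial
  exact hu trivial

/-- Every cut set has a prime of the same height as that of ∅, which is n - 1 because G is
connected. -/
theorem isUnmixed_of_dualGraph_connected (hconn : G.Connected)
    (hdual : (dualGraph (binomialEdgeIdeal K G)).Connected) : IsUnmixed G := by
  intro S hS
  have : Nonempty V := hconn.nonempty
  have h := height_eq_of_dualGraph_connected hdual ⟨_, cutIdeal_mem_minimalPrimes hS⟩
    ⟨_, cutIdeal_mem_minimalPrimes isCutSet_empty⟩
  have h1 := height_cutIdeal (K := K) (G := G) hS.ne_univ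
  have h2 := height_cutIdeal (K := K) (G := G) (isCutSet_empty (G := G)).ne_univ
  simp only at h
  rw [h] at h1
  rw [numComponents_empty hconn, Set.ncard_empty] at h2
  have h3 : (cutIdeal K G ∅).height ≠ ⊤ :=
    ne_top_of_le_ne_top (ENat.natCast_ne_top _) (height_le_two_mul _)
  lift (cutIdeal K G ∅).height to ℕ using h3 with k
  norm_cast at h1 h2
  omega

end MinimalPrimes

/-! ### Adjacency in the dual graph. -/

section DualGraph

open MvPolynomial

variable {K : Type*} [Field K] {V : Type*}

/-- Two vertices are equivalent modulo a prime `p` if their columns are both zero, or nonzero and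
proportional. -/
def proportionalSetoid (p : Ideal (MvPolynomial (V ⊕ V) K)) [p.IsPrime] : Setoid V where
  r u v := (u ∈ zeroSet p ∧ v ∈ zeroSet p) ∨ (u ∉ zeroSet p ∧ v ∉ zeroSet p ∧ minor K u v ∈ p)
  iseqv := by
    refine ⟨fun u => ?_, ?_, ?_⟩
    · by_cases h : u ∈ zeroSet p
      · exact Or.inl ⟨h, h⟩
      · exact Or.inr ⟨h, h, minor_self_mem p u⟩
    · rintro u v (⟨h1, h2⟩ | ⟨h1, h2, h3⟩)
      · exact Or.inl ⟨h2, h1⟩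
      · exact Or.inr ⟨h2, h1, minor_mem_comm h3⟩
    · rintro u v w (⟨h1, h2⟩ | ⟨h1, h2, h3⟩) (⟨h4, h5⟩ | ⟨h4, h5, h6⟩)
      · exact Or.inl ⟨h1, h5⟩
      · exact absurd h2 h4
      · exact absurd h4 h2
      · exact Or.inr ⟨h1, h5, minor_mem_trans h2 h3 h6⟩

variable (p : Ideal (MvPolynomial (V ⊕ V) K)) [p.IsPrime]

open Classical in
/-- The labelling of the vertices with nonzero column by proportionality modulo `p`. -/
noncomputable def primeLabel (v : V) : Option V :=
  if v ∈ zeroSet p then none else some (Quotient.out (Quotient.mk (proportionalSetoid p) v))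

variable {p}

lemma primeLabel_eq_none {v : V} : primeLabel p v = none ↔ v ∈ zeroSet p := by
  simp [primeLabel]

lemma primeLabel_eq {u v : V} (hu : u ∉ zeroSet p) (hv : v ∉ zeroSet p) :
    primeLabel p u = primeLabel p v ↔ minor K u v ∈ p := by
  rw [primeLabel, primeLabel, if_neg hu, if_neg hv, Option.some_inj, Quotient.out_inj,
    Quotient.eq]
  exact ⟨fun h => (h.resolve_left fun h => hu h.1).2.2, fun h => Or.inr ⟨hu, hv, h⟩⟩

lemma primeLabel_idem {v i : V} (h : primeLabel p v = some i) :
    i ∉ zeroSet p ∧ primeLabel p i = some i := by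
  have hv : v ∉ zeroSet p := fun hv => by simp [primeLabel_eq_none.2 hv] at h
  rw [primeLabel, if_neg hv, Option.some_inj] at h
  have hvi : (proportionalSetoid p).r i v := by
    rw [← h]
    exact Quotient.mk_out (s := proportionalSetoid p) v
  have hi : i ∉ zeroSet p := by
    rcases hvi with h' | h'
    exacts [absurd h'.2 hv, h'.1]
  refine ⟨hi, ?_⟩
  rw [primeLabel, if_neg hi, Quotient.sound (s := proportionalSetoid p) hvi, h]

lemma numNone_primeLabel : numNone (primeLabel p) = (zeroSet p).ncard := by
  rw [numNone]
  congr 1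
  ext v
  exact primeLabel_eq_none

lemma labelIdeal_primeLabel_le : labelIdeal K (primeLabel p) ≤ p := by
  refine labelIdeal_le (fun v hv => primeLabel_eq_none.1 hv) fun u v i hu hv => ?_
  have hu' : u ∉ zeroSet p := fun h => by simp [primeLabel_eq_none.2 h] at hu
  have hv' : v ∉ zeroSet p := fun h => by simp [primeLabel_eq_none.2 h] at hv
  exact (primeLabel_eq hu' hv').1 (hu.trans hv.symm)

variable {G : SimpleGraph V} {S : Set V}

lemma mapsTo_primeLabel (hp : cutIdeal K G S ≤ p) :
    ∀ i ∈ {i | ∃ v, primeLabel p v = some i},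
      (isolate G S).connectedComponentMk i ∈ (isolate G S).connectedComponentMk '' Sᶜ := by
  rintro i ⟨v, hv⟩
  refine ⟨i, fun hi => (primeLabel_idem hv).1 ?_, rfl⟩
  exact zeroSet_mono hp ((zeroSet_cutIdeal (K := K) (G := G) S).symm ▸ hi)

lemma injOn_primeLabel (hp : cutIdeal K G S ≤ p) :
    Set.InjOn (isolate G S).connectedComponentMk {i | ∃ v, primeLabel p v = some i} := by
  rintro i ⟨v, hv⟩ j ⟨w, hw⟩ hij
  obtain ⟨hi, hi'⟩ := primeLabel_idem hv
  obtain ⟨hj, hj'⟩ := primeLabel_idem hw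
  have hmem : minor K i j ∈ cutIdeal K G S :=
    minor_mem_cutIdeal.2 (Or.inr (Or.inr (SimpleGraph.ConnectedComponent.exact hij)))
  have := (primeLabel_eq hi hj).2 (hp hmem)
  rw [hi', hj'] at this
  exact Option.some_inj.1 this

variable [Finite V]

/-- Each proportionality class is represented by a vertex outside S, and representatives in one
component of G - S would be proportional modulo p. -/
lemma numLabels_primeLabel_le (hp : cutIdeal K G S ≤ p) :
    numLabels (primeLabel p) ≤ numComponents G S := by
  rw [numComponents_eq_ncard]
  exact Set.ncard_le_ncard_of_injOn _ (mapsTo_primeLabel hp) (injOn_primeLabel hp)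

/-- The prime of the labelling has height |Z| + n - k, with Z the zero set and k the number of
labels, and lies in p. The formula needs a labelled vertex; were Z everything, p would strictly
contain a prime of height 2n - 2, impossible for n ≥ 2. -/
lemma ncard_zeroSet_le (hV : 2 ≤ Nat.card V) (hp : p.height = Nat.card V) :
    (zeroSet p).ncard ≤ numLabels (primeLabel p) := by
  classical
  by_cases huniv : zeroSet p = Set.univ
  · exfalso
    obtain ⟨v, w, hvw⟩ : ∃ v w : V, v ≠ w := by
      have : Nontrivial V := Finite.one_lt_card_iff_nontrivial.1 hV
      exact exists_pair_ne V
    set d : V → Option V := fun u => if u = v then some v else none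
    have h0 : ∀ u, u ∈ zeroSet p := fun u => huniv ▸ Set.mem_univ u
    have hlt : labelIdeal K d < p := by
      refine lt_of_le_of_ne (labelIdeal_le (fun u _ => h0 u) fun a b _ _ _ => ?_) ?_
      · exact sub_mem (p.mul_mem_right _ (h0 a).1) (p.mul_mem_right _ (h0 b).1)
      · intro h
        have := (h0 v).1
        rw [← h, X_inl_mem_labelIdeal] at this
        simp [d] at this
    have h1 := Ideal.height_add_one_le_of_lt_of_isPrime hlt
    have h2 := height_labelIdeal (K := K) d ⟨v, by simp [d]⟩
    have e1 : numLabels d = 1 := by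
      rw [numLabels, Set.ncard_eq_one]
      refine ⟨v, Set.ext fun l => ⟨?_, ?_⟩⟩
      · rintro ⟨u, hu⟩
        by_cases h : u = v
        · simp only [d, h, if_true, Option.some_inj] at hu
          exact hu.symm
        · simp [d, h] at hu
      · rintro rfl
        exact ⟨l, by simp [d]⟩
    have e2 : numNone d + 1 = Nat.card V := by
      rw [numNone, ← Set.ncard_univ, ← Set.ncard_sdiff_singleton_add_one (Set.mem_univ v)]
      congr 2
      ext u
      simp [d]
    rw [hp] at h1
    have h3 : (labelIdeal K d).height ≠ ⊤ :=
      ne_top_of_le_ne_top (ENat.natCast_ne_top _) (height_le_two_mul _)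
    lift (labelIdeal K d).height to ℕ using h3 with k
    norm_cast at h1 h2
    omega
  · obtain ⟨v, hv⟩ := (Set.ne_univ_iff_exists_notMem _).1 huniv
    have h1 := height_labelIdeal (K := K) (primeLabel p)
      ⟨v, fun h => hv (primeLabel_eq_none.1 h)⟩
    have h2 := Ideal.height_mono (labelIdeal_primeLabel_le (p := p))
    rw [hp] at h2
    rw [numNone_primeLabel] at h1
    have h3 : (labelIdeal K (primeLabel p)).height ≠ ⊤ :=
      ne_top_of_le_ne_top (ENat.natCast_ne_top _) (height_le_two_mul _)
    lift (labelIdeal K (primeLabel p)).height to ℕ using h3 with k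
    norm_cast at h1 h2
    omega

/-- Equal counts make the injection from classes to components a bijection, so proportional columns
cannot come from different components. -/
lemma reachable_of_numLabels_eq (hp : cutIdeal K G S ≤ p)
    (hcard : numComponents G S ≤ numLabels (primeLabel p)) {u v : V} (hu : u ∉ zeroSet p)
    (hv : v ∉ zeroSet p) (huv : minor K u v ∈ p) : (isolate G S).Reachable u v := by
  have hsub : S ⊆ zeroSet p := zeroSet_cutIdeal (K := K) (G := G) S ▸ zeroSet_mono hp
  have himg : (isolate G S).connectedComponentMk '' {i | ∃ v, primeLabel p v = some i} =
      (isolate G S).connectedComponentMk '' Sᶜ := by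
    refine Set.eq_of_subset_of_ncard_le ?_ ?_
    · rintro _ ⟨i, hi, rfl⟩
      exact mapsTo_primeLabel hp i hi
    · rw [(injOn_primeLabel hp).ncard_image, ← numComponents_eq_ncard]
      exact hcard
  have key : ∀ w, w ∉ zeroSet p → ∃ i, primeLabel p w = some i ∧ (isolate G S).Reachable i w := by
    intro w hw
    have : (isolate G S).connectedComponentMk w ∈ (isolate G S).connectedComponentMk '' Sᶜ :=
      ⟨w, fun h => hw (hsub h), rfl⟩
    rw [← himg] at this
    obtain ⟨i, ⟨x, hx⟩, hiw⟩ := this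
    obtain ⟨hi, hi'⟩ := primeLabel_idem hx
    have hiw' := SimpleGraph.ConnectedComponent.exact hiw
    refine ⟨i, ?_, hiw'⟩
    rw [← hi', eq_comm, primeLabel_eq hi hw]
    exact hp (minor_mem_cutIdeal.2 (Or.inr (Or.inr hiw')))
  obtain ⟨i, hi, hiu⟩ := key u hu
  obtain ⟨j, hj, hjv⟩ := key v hv
  have := (primeLabel_eq hu hv).2 huv
  rw [hi, hj, Option.some_inj] at this
  subst this
  exact hiu.symm.trans hjv

/-- In G - (R ∪ {t}) the neighbours of s are joined through s, so their columns are proportional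
modulo p and they share one component of G - (R ∪ {s}). Only t can add a second attached component,
whence c(R) ≥ |R| + 1. -/
lemma isCutSet_of_swap (hG : IsUnmixed G) {R : Set V} {s t : V} (hs : s ∉ R)
    (hst : s ≠ t) (hScut : IsCutSet G (insert s R))
    (hpS : cutIdeal K G (insert s R) ≤ p) (hpT : cutIdeal K G (insert t R) ≤ p)
    (hZ : zeroSet p = insert t (insert s R))
    (hcard : numComponents G (insert s R) ≤ numLabels (primeLabel p)) : IsCutSet G R := by
  have hd : (attached G R s).ncard ≤ 2 := by
    by_contra! h
    rw [Set.two_lt_ncard_iff] at h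
    obtain ⟨_, _, _, ⟨a, ha, rfl⟩, ⟨b, hb, rfl⟩, ⟨c, hc, rfl⟩, hab, hac, hbc⟩ := h
    have key : ∀ x y, G.Adj s x ∧ x ∉ R → G.Adj s y ∧ y ∉ R → x ≠ t → y ≠ t →
        (isolate G (insert s R)).connectedComponentMk x =
          (isolate G (insert s R)).connectedComponentMk y := by
      intro x y hx hy hxt hyt
      have hxT : x ∉ insert t R := by rintro (h | h); exacts [hxt h, hx.2 h]
      have hyT : y ∉ insert t R := by rintro (h | h); exacts [hyt h, hy.2 h]
      have hsT : s ∉ insert t R := by rintro (h | h); exacts [hst h, hs h]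
      have h1 : (isolate G (insert t R)).Adj s x := ⟨hx.1, hsT, hxT⟩
      have h2 : (isolate G (insert t R)).Adj s y := ⟨hy.1, hsT, hyT⟩
      have hxZ : x ∉ zeroSet p := by
        rw [hZ, Set.insert_comm]
        rintro (h | h)
        exacts [hx.1.ne' h, hxT h]
      have hyZ : y ∉ zeroSet p := by
        rw [hZ, Set.insert_comm]
        rintro (h | h)
        exacts [hy.1.ne' h, hyT h]
      exact SimpleGraph.ConnectedComponent.sound (reachable_of_numLabels_eq hpS hcard hxZ hyZ
        (hpT (minor_mem_cutIdeal.2 (Or.inr (Or.inr (h1.symm.reachable.trans h2.reachable))))))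
    by_cases hat : a = t
    · have hbt : b ≠ t := fun h => hab (by rw [hat, h])
      have hct : c ≠ t := fun h => hac (by rw [hat, h])
      exact hbc (key b c hb hc hbt hct)
    · by_cases hbt : b = t
      · have hct : c ≠ t := fun h => hbc (by rw [hbt, h])
        exact hac (key a c ha hc hat hct)
      · exact hab (key a b ha hb hat hbt)
  have h1 := numComponents_insert (G := G) hs
  have h2 := hG _ hScut
  rw [Set.ncard_insert_of_notMem hs] at h2
  exact hG.isCutSet (by omega)

/-- Adjacent vertices of the dual graph come from cut sets that differ by one vertex, or by an
exchange of two vertices whose common part is a cut set. -/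
lemma cutSets_of_height_sup (hconn : G.Connected) (hG : IsUnmixed G) {T : Set V}
    (hS : IsCutSet G S) (hT : IsCutSet G T) (hne : S ≠ T)
    (hht : (cutIdeal K G S + cutIdeal K G T).height = (cutIdeal K G S).height + 1) :
    (∃ s ∉ T, insert s T = S) ∨ (∃ t ∉ S, insert t S = T) ∨
      ∃ R s t, s ∉ R ∧ t ∉ R ∧ insert s R = S ∧ insert t R = T ∧ IsCutSet G R := by
  have : Nonempty V := hconn.nonempty
  have hV : 2 ≤ Nat.card V := by
    obtain ⟨A, hA, x, hx⟩ : ∃ A : Set V, IsCutSet G A ∧ A.Nonempty := by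
      by_cases h : S.Nonempty
      · exact ⟨S, hS, h⟩
      · rw [Set.not_nonempty_iff_eq_empty] at h
        exact ⟨T, hT, Set.nonempty_iff_ne_empty.2 fun h' => hne (h.trans h'.symm)⟩
    obtain ⟨u, -, -, -, hu, -⟩ := isCutSet_iff.1 hA x hx
    exact Finite.one_lt_card_iff_nontrivial.2 ⟨x, u, fun h => hu (h ▸ hx)⟩
  have hSc := hG S hS
  have hTc := hG T hT
  -- By unmixedness the prime of S has height n - 1.
  have hsum : (cutIdeal K G S + cutIdeal K G T).height = (Nat.card V : ℕ∞) := by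
    have h1 := height_cutIdeal (K := K) (G := G) hS.ne_univ
    have h3 : (cutIdeal K G S).height ≠ ⊤ :=
      ne_top_of_le_ne_top (ENat.natCast_ne_top _) (height_le_two_mul _)
    rw [hht]
    lift (cutIdeal K G S).height to ℕ using h3 with k
    norm_cast at h1 ⊢
    omega
  obtain ⟨p, hp, hle, hph⟩ := Ideal.exists_isPrime_height_eq hsum
  have hpS : cutIdeal K G S ≤ p := le_sup_left.trans hle
  have hpT : cutIdeal K G T ≤ p := le_sup_right.trans hle
  have hSZ : S ⊆ zeroSet p := zeroSet_cutIdeal (K := K) (G := G) S ▸ zeroSet_mono hpS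
  have hTZ : T ⊆ zeroSet p := zeroSet_cutIdeal (K := K) (G := G) T ▸ zeroSet_mono hpT
  -- Together these give |Z| ≤ k ≤ |S| + 1, and likewise for T, so Z exceeds each of S and T by at
  -- most one vertex.
  have hk := ncard_zeroSet_le hV hph
  have hkS := numLabels_primeLabel_le hpS
  have hkT := numLabels_primeLabel_le hpT
  have hcS := Set.ncard_le_ncard hSZ
  have hcT := Set.ncard_le_ncard hTZ
  by_cases hTS : T ⊆ S
  · left
    rw [Set.exists_eq_insert_iff_ncard]
    have := Set.ncard_lt_ncard (hTS.ssubset_of_ne hne.symm)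
    exact ⟨hTS, by omega⟩
  by_cases hST : S ⊆ T
  · right; left
    rw [Set.exists_eq_insert_iff_ncard]
    have := Set.ncard_lt_ncard (hST.ssubset_of_ne hne)
    exact ⟨hST, by omega⟩
  right; right
  obtain ⟨s, hsS, hsT⟩ := Set.not_subset.1 hST
  obtain ⟨t, htT, htS⟩ := Set.not_subset.1 hTS
  have hst : s ≠ t := fun h => hsT (h ▸ htT)
  have hZS : insert t S = zeroSet p := Set.eq_of_subset_of_ncard_le
    (Set.insert_subset (hTZ htT) hSZ) (by rw [Set.ncard_insert_of_notMem htS]; omega)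
  have hZT : insert s T = zeroSet p := Set.eq_of_subset_of_ncard_le
    (Set.insert_subset (hSZ hsS) hTZ) (by rw [Set.ncard_insert_of_notMem hsT]; omega)
  have hsR : s ∉ S \ {s} := by simp
  have htR : t ∉ S \ {s} := fun h => htS h.1
  have eS : insert s (S \ {s}) = S := by
    rw [Set.insert_sdiff_singleton, Set.insert_eq_of_mem hsS]
  have eT : insert t (S \ {s}) = T := by
    rw [← Set.insert_sdiff_self_of_notMem hsT, hZT, ← hZS,
      Set.insert_sdiff_of_notMem _ (by simpa using hst.symm)]
  have hcZ : (zeroSet p).ncard = S.ncard + 1 := by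
    rw [← hZS, Set.ncard_insert_of_notMem htS]
  refine ⟨S \ {s}, s, t, hsR, htR, eS, eT, ?_⟩
  refine isCutSet_of_swap (p := p) hG hsR hst (eS.symm ▸ hS) (eS.symm ▸ hpS) (eT.symm ▸ hpT)
    (by rw [eS, hZS]) ?_
  rw [eS]
  omega

/-- Along a path of the dual graph from the prime of ∅, each step removes a vertex, adds one, or
does both through the common cut set R. -/
theorem upReachable_of_isCutSet (hconn : G.Connected) (hbip : G.IsBipartite)
    (hdual : (dualGraph (binomialEdgeIdeal K G)).Connected) (hS : IsCutSet G S) :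
    UpReachable G S := by
  have hG := isUnmixed_of_dualGraph_connected hconn hdual
  have hpath := hdual.preconnected ⟨_, cutIdeal_mem_minimalPrimes isCutSet_empty⟩
    ⟨_, cutIdeal_mem_minimalPrimes hS⟩
  suffices h : ∀ q : (binomialEdgeIdeal K G).minimalPrimes,
      (dualGraph (binomialEdgeIdeal K G)).Reachable
        ⟨_, cutIdeal_mem_minimalPrimes isCutSet_empty⟩ q → UpReachable G (zeroSet q.1) by
    have := h _ hpath
    rwa [zeroSet_cutIdeal] at this
  intro q hq
  rw [SimpleGraph.reachable_iff_reflTransGen] at hq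
  induction hq with
  | refl =>
    rw [zeroSet_cutIdeal]
    exact UpReachable.empty
  | @tail p q _ hpq ih =>
    obtain ⟨p, hp⟩ := p
    obtain ⟨q, hq⟩ := q
    obtain ⟨S, hS, rfl⟩ := exists_isCutSet_of_mem_minimalPrimes hp
    obtain ⟨T, hT, rfl⟩ := exists_isCutSet_of_mem_minimalPrimes hq
    rw [zeroSet_cutIdeal] at ih ⊢
    have hne : S ≠ T := by
      rintro rfl
      exact hpq.1 rfl
    rcases cutSets_of_height_sup hconn hG hS hT hne hpq.2.1 with
      ⟨s, hs, rfl⟩ | ⟨t, ht, rfl⟩ | ⟨R, s, t, hs, ht, rfl, rfl, hR⟩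
    · exact ih.of_insert hG hbip hs hT
    · exact ih.add_vertex ht hT
    · exact (ih.of_insert hG hbip hs hR).add_vertex ht hT

end DualGraph

end BinomialEdge

theorem theorem4p6 (K : Type*) [Field K] {V : Type*} [Finite V] (G : SimpleGraph V)
    (hconn : G.Connected) (hbip : G.IsBipartite)
    (hdual : (BinomialEdge.dualGraph (BinomialEdge.binomialEdgeIdeal K G)).Connected)
    (S : Set V) (hS : BinomialEdge.IsCutSet G S) (hne : S.Nonempty) :
    ∃ s ∈ S, BinomialEdge.IsCutSet G (S \ {s}) := by
  cases BinomialEdge.upReachable_of_isCutSet hconn hbip hdual hS with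
  | empty => exact absurd hne Set.not_nonempty_empty
  | @add_vertex T v hT hv _ =>
    refine ⟨v, Set.mem_insert _ _, ?_⟩
    rw [Set.insert_sdiff_self_of_notMem hv]
    exact hT.isCutSet
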